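/- **Proposition 4.2.A.** There is a constant $C_2\ge 1$ and, for every $m$, a constant $C_1\ge 0$ depending only on $m$, with the following property. Equip $\mathbb R^{2m}$ with the standard symplectic form $\sum_{i=1}^m dq_i\wedge dp_i$ and let $\mu$ be Lebesgue measure. Let $X\subset\mathbb R^{2m}$ be a non-empty compact connected set (for instance a closed bounded connected domain with piecewise smooth boundary), let $U\supset X$ be an open set with compact closure, and let $G_U$ be the group of Hamiltonian diffeomorphisms generated by Hamiltonian functions supported in $U$, that is, of time-one maps of flows of smooth time-dependent Hamiltonians vanishing at all times outside a compact subset of $U$. Then for every non-empty open subset $A$ of the interior of $X$ there are finitely many $g_1,\dots,g_M\in G_U$ (repetitions allowed) such that $X\subset\bigcup_{j=1}^M g_j(A)$ and $$\frac1M\sum_{j=1}^M \chi_{g_j(A)}(x)\ \ge\ \Bigl(C_1+C_2\,\frac{\mu(X)}{\mu(A)}\Bigr)^{-1}\qquad\text{for all }x\in X,$$ where $\chi_S$ denotes the indicator function of $S$. -/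

import Mathlib

open MeasureTheory
open scoped ContDiff

/-- The space `ℝ²ᵐ`, with coordinates `q i = x (Sum.inl i)` and `p i = x (Sum.inr i)`. -/
abbrev SympSpace (m : ℕ) : Type := EuclideanSpace ℝ (Fin m ⊕ Fin m)

/-- The standard symplectic form `∑ dqᵢ ∧ dpᵢ`. -/
noncomputable def stdSymplecticForm {m : ℕ} (v w : SympSpace m) : ℝ :=
  ∑ i : Fin m, (v (Sum.inl i) * w (Sum.inr i) - v (Sum.inr i) * w (Sum.inl i))

/-- The Hamiltonian vector field `(∂F/∂p, -∂F/∂q)` of a function `F` on `ℝ²ᵐ`. -/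
noncomputable def hamiltonianVectorField {m : ℕ} (F : SympSpace m → ℝ) (x : SympSpace m) :
    SympSpace m :=
  WithLp.toLp 2 (Sum.elim
    (fun i => fderiv ℝ F x (EuclideanSpace.single (Sum.inr i) 1))
    (fun i => -fderiv ℝ F x (EuclideanSpace.single (Sum.inl i) 1)))

/-- The Hamiltonian vector field is the symplectic gradient: `ω(X_F, w) = dF(w)`. -/
theorem stdSymplecticForm_hamiltonianVectorField {m : ℕ} (F : SympSpace m → ℝ)
    (x w : SympSpace m) :
    stdSymplecticForm (hamiltonianVectorField F x) w = fderiv ℝ F x w := by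
  have hw : w = ∑ k, w k • EuclideanSpace.single k (1 : ℝ) := by
    have h := (EuclideanSpace.basisFun (Fin m ⊕ Fin m) ℝ).sum_repr w
    simpa using h.symm
  conv_rhs => rw [hw]
  rw [map_sum, Fintype.sum_sum_type]
  simp only [stdSymplecticForm, hamiltonianVectorField, map_smul, smul_eq_mul, Sum.elim_inl,
    Sum.elim_inr]
  rw [← Finset.sum_add_distrib]
  refine Finset.sum_congr rfl fun i _ => ?_
  ring

/-- The set `G_U` of Hamiltonian diffeomorphisms of `ℝ²ᵐ` generated by Hamiltonian functions
supported in `U`: the time-one maps of the flows of smooth time-dependent Hamiltonian functions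
`H` that vanish, at all times, outside some compact subset of `U`. (Such a flow exists, is
unique, and consists of diffeomorphisms.) -/
def hamiltonianDiffeos {m : ℕ} (U : Set (SympSpace m)) : Set (SympSpace m → SympSpace m) :=
  {g | ∃ (H : ℝ → SympSpace m → ℝ) (φ : ℝ → SympSpace m → SympSpace m)
      (K : Set (SympSpace m)),
    ContDiff ℝ ∞ (fun z : ℝ × SympSpace m => H z.1 z.2) ∧
    IsCompact K ∧ K ⊆ U ∧ (∀ t, ∀ x ∉ K, H t x = 0) ∧
    (∀ x, φ 0 x = x) ∧
    (∀ t x, HasDerivAt (fun s => φ s x) (hamiltonianVectorField (H t) (φ t x)) t) ∧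
    g = φ 1}

/-- The counting function `x ↦ ∑ⱼ χ_{Aⱼ}(x)` of a finite family of sets. -/
noncomputable def countingFunction {E : Type*} {M : ℕ} (A : Fin M → Set E) (x : E) : ℝ :=
  ∑ j, (A j).indicator (fun _ => (1 : ℝ)) x

/-!
The family is found by an averaging argument. Let `V` be a connected open set with `X ⊆ V ⊆ U` and
`μ V ≤ 2 μ X`, let `φ ≤ χ_A` be a bump function with `∫ φ ≥ μ A / 2`, and let `G` be the monoid of
those Hamiltonian diffeomorphisms generated in `V` that preserve the volume and fix the complement
of `V`. It suffices to find a finite convex combination of the functions `φ ∘ g⁻¹`, `g ∈ G`, which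
is bounded below on `X` by a fixed multiple of the mean value `c = ∫ φ / μ V`: rounding its weights
to equal ones costs a factor `2` (`exists_uniform_average_ge`).

Enough elements of `G` are given explicitly, so no existence theorem for flows is needed. A radial
Hamiltonian `k(|x - c|²)` generates a *twist*, which rotates each sphere about `c` by a phase
depending on the radius; it preserves the volume because its derivative is an orthogonal map times
a transvection. Two twists that are opposite rigid rotations about nearby centres compose to a
translation near those centres, so `G` contains all small local translations
(`exists_local_translation`).

A function invariant under `G` is therefore constant almost everywhere on the connected set `V`
(`exists_ae_eq_const`). The vector of least norm in the closed convex hull of the orbit of `φ` in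
`L²(V)` is invariant, hence it is the constant `c`, and convex combinations of the `φ ∘ g⁻¹`
approach `c` in `L¹(V)` (`exists_mem_orbitHull_integral_abs_sub_lt`). Averaging such a combination
over small local translations, successively around finitely many points of `X`, turns `L¹` closeness
into the lower bound `c / 2` at every point of `X` (`exists_smoothing`, `exists_mem_orbitHull_ge`).
-/

/-! ### Hamiltonian diffeomorphisms under composition -/

lemma hamiltonianVectorField_const_mul {m : ℕ} {F : SympSpace m → ℝ} (hF : Differentiable ℝ F)
    (c : ℝ) (x : SympSpace m) :
    hamiltonianVectorField (fun y => c * F y) x = c • hamiltonianVectorField F x := by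
  ext i
  rcases i with i | i <;>
    simp [hamiltonianVectorField, fderiv_const_mul (hF x) c]

lemma hamiltonianVectorField_zero {m : ℕ} (x : SympSpace m) :
    hamiltonianVectorField (fun _ : SympSpace m => (0 : ℝ)) x = 0 := by
  ext i
  rcases i with i | i <;> simp [hamiltonianVectorField]

lemma id_mem_hamiltonianDiffeos {m : ℕ} (U : Set (SympSpace m)) :
    (id : SympSpace m → SympSpace m) ∈ hamiltonianDiffeos U := by
  refine ⟨fun _ _ => 0, fun _ x => x, ∅, contDiff_const, isCompact_empty, Set.empty_subset _,
    fun _ _ _ => rfl, fun _ => rfl, fun t x => ?_, rfl⟩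
  rw [hamiltonianVectorField_zero]
  exact hasDerivAt_const _ _

lemma hamiltonianDiffeos_mono {m : ℕ} {U V : Set (SympSpace m)} (h : U ⊆ V) :
    hamiltonianDiffeos U ⊆ hamiltonianDiffeos V := by
  rintro g ⟨H, φ, K, h1, h2, h3, h4⟩
  exact ⟨H, φ, K, h1, h2, h3.trans h, h4⟩

/-- The two flows are run one after the other. Reparametrizing time by smooth steps `a` and `b`
whose derivatives have disjoint supports keeps the concatenated Hamiltonian smooth in time. -/
lemma comp_mem_hamiltonianDiffeos {m : ℕ} {U : Set (SympSpace m)}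
    {g₁ g₂ : SympSpace m → SympSpace m} (h₁ : g₁ ∈ hamiltonianDiffeos U)
    (h₂ : g₂ ∈ hamiltonianDiffeos U) : g₂ ∘ g₁ ∈ hamiltonianDiffeos U := by
  obtain ⟨H₁, φ₁, K₁, hH₁, hK₁, hKU₁, hv₁, hi₁, hd₁, rfl⟩ := h₁
  obtain ⟨H₂, φ₂, K₂, hH₂, hK₂, hKU₂, hv₂, hi₂, hd₂, rfl⟩ := h₂
  -- `a` rises from `0` to `1` on `[0, 1/3]` and `b` does so on `[2/3, 1]`
  let a : ℝ → ℝ := fun t => Real.smoothTransition (3 * t)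
  let b : ℝ → ℝ := fun t => Real.smoothTransition (3 * t - 2)
  have ha : ContDiff ℝ ∞ a :=
    Real.smoothTransition.contDiff.comp (contDiff_const.mul contDiff_id)
  have hb : ContDiff ℝ ∞ b :=
    Real.smoothTransition.contDiff.comp ((contDiff_const.mul contDiff_id).sub contDiff_const)
  have ha' : ContDiff ℝ ∞ (deriv a) := (contDiff_infty_iff_deriv.1 ha).2
  have hb' : ContDiff ℝ ∞ (deriv b) := (contDiff_infty_iff_deriv.1 hb).2
  have ha1 : ∀ t, 1 / 3 ≤ t → a t = 1 := fun t ht =>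
    Real.smoothTransition.one_of_one_le (by linarith)
  have hb0 : ∀ t, t ≤ 2 / 3 → b t = 0 := fun t ht =>
    Real.smoothTransition.zero_of_nonpos (by linarith)
  have hH₁t : ∀ t, Differentiable ℝ (H₁ t) := fun t =>
    ((hH₁.comp (contDiff_const (c := t) |>.prodMk contDiff_id)).differentiable (by simp))
  have hH₂t : ∀ t, Differentiable ℝ (H₂ t) := fun t =>
    ((hH₂.comp (contDiff_const (c := t) |>.prodMk contDiff_id)).differentiable (by simp))
  refine ⟨fun t x => deriv a t * H₁ (a t) x + deriv b t * H₂ (b t) x,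
    fun t x => φ₂ (b t) (φ₁ (a t) x), K₁ ∪ K₂, ?_, hK₁.union hK₂, Set.union_subset hKU₁ hKU₂,
    ?_, ?_, ?_, ?_⟩
  · have e1 : ContDiff ℝ ∞ (fun z : ℝ × SympSpace m => H₁ (a z.1) z.2) :=
      hH₁.comp ((ha.comp contDiff_fst).prodMk contDiff_snd)
    have e2 : ContDiff ℝ ∞ (fun z : ℝ × SympSpace m => H₂ (b z.1) z.2) :=
      hH₂.comp ((hb.comp contDiff_fst).prodMk contDiff_snd)
    exact ((ha'.comp contDiff_fst).mul e1).add ((hb'.comp contDiff_fst).mul e2)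
  · intro t x hx
    rw [Set.mem_union, not_or] at hx
    simp [hv₁ _ x hx.1, hv₂ _ x hx.2]
  · intro x
    have : a 0 = 0 := Real.smoothTransition.zero_of_nonpos (by simp)
    simp [this, hb0 0 (by norm_num), hi₁, hi₂]
  · intro t x
    rcases lt_or_ge (1 / 2) t with ht | ht
    · -- the first flow has already arrived
      have hev : ∀ᶠ s in nhds t, a s = 1 := by
        filter_upwards [lt_mem_nhds ht] with s hs using ha1 s (by linarith)
      have hda : deriv a t = 0 := by
        rw [Filter.EventuallyEq.deriv_eq (f := fun _ => (1 : ℝ)) hev]; simp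
      have h3 := (hd₂ (b t) (φ₁ 1 x)).scomp t
        ((hb.differentiable (by simp) t).hasDerivAt)
      beta_reduce
      rw [ha1 t (by linarith)]
      simp only [hda, zero_mul, zero_add]
      rw [hamiltonianVectorField_const_mul (hH₂t _)]
      refine h3.congr_of_eventuallyEq ?_
      filter_upwards [hev] with s hs
      simp [hs]
    · -- the second flow has not started
      have ht' : t < 2 / 3 := by linarith
      have hev : ∀ᶠ s in nhds t, b s = 0 := by
        filter_upwards [gt_mem_nhds ht'] with s hs using hb0 s hs.le
      have hdb : deriv b t = 0 := by
        rw [Filter.EventuallyEq.deriv_eq (f := fun _ => (0 : ℝ)) hev]; simp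
      have h3 := (hd₁ (a t) x).scomp t ((ha.differentiable (by simp) t).hasDerivAt)
      beta_reduce
      rw [hb0 t ht'.le]
      simp only [hdb, zero_mul, add_zero, hi₂]
      rw [hamiltonianVectorField_const_mul (hH₁t _)]
      refine h3.congr_of_eventuallyEq ?_
      filter_upwards [hev] with s hs
      simp [hs, hi₂]
  · funext x
    simp [ha1 1 (by norm_num), show b 1 = 1 from
      Real.smoothTransition.one_of_one_le (by norm_num)]

/-! ### Phase rotations and twists -/

/-- The complex structure `(q, p) ↦ (p, -q)`, which turns gradients into Hamiltonian vector
fields. -/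
noncomputable def complexStructure (m : ℕ) : SympSpace m →L[ℝ] SympSpace m :=
  LinearMap.toContinuousLinearMap
    { toFun := fun x => WithLp.toLp 2 (Sum.elim (fun i => x (Sum.inr i)) (fun i => -x (Sum.inl i)))
      map_add' := fun x y => by
        ext i; rcases i with i | i <;> simp [add_comm]
      map_smul' := fun c x => by
        ext i; rcases i with i | i <;> simp }

@[simp] lemma complexStructure_inl {m : ℕ} (x : SympSpace m) (i : Fin m) :
    complexStructure m x (Sum.inl i) = x (Sum.inr i) := rfl

@[simp] lemma complexStructure_inr {m : ℕ} (x : SympSpace m) (i : Fin m) :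
    complexStructure m x (Sum.inr i) = -x (Sum.inl i) := rfl

@[simp] lemma complexStructure_complexStructure {m : ℕ} (x : SympSpace m) :
    complexStructure m (complexStructure m x) = -x := by
  ext i; rcases i with i | i <;> simp

lemma inner_complexStructure_self {m : ℕ} (x : SympSpace m) :
    inner ℝ x (complexStructure m x) = 0 := by
  simp only [PiLp.inner_apply, Fintype.sum_sum_type, complexStructure_inl, complexStructure_inr]
  rw [← Finset.sum_add_distrib]
  refine Finset.sum_eq_zero fun i _ => ?_
  simp
  ring

lemma norm_complexStructure {m : ℕ} (x : SympSpace m) : ‖complexStructure m x‖ = ‖x‖ := by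
  rw [EuclideanSpace.norm_eq, EuclideanSpace.norm_eq]
  simp [Fintype.sum_sum_type, add_comm]

lemma hamiltonianVectorField_of_hasFDerivAt {m : ℕ} {F : SympSpace m → ℝ} {x u : SympSpace m}
    {c : ℝ} (h : HasFDerivAt F (c • innerSL ℝ u) x) :
    hamiltonianVectorField F x = c • complexStructure m u := by
  ext i
  rcases i with i | i <;>
    simp [hamiltonianVectorField, h.fderiv, EuclideanSpace.inner_single_right]

/-- Multiplication by `e^{iθ}` for the complex structure `complexStructure m`. -/
noncomputable def phaseRotation (m : ℕ) (θ : ℝ) : SympSpace m →L[ℝ] SympSpace m :=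
  Real.cos θ • ContinuousLinearMap.id ℝ (SympSpace m) + Real.sin θ • complexStructure m

lemma phaseRotation_apply {m : ℕ} (θ : ℝ) (x : SympSpace m) :
    phaseRotation m θ x = Real.cos θ • x + Real.sin θ • complexStructure m x := rfl

@[simp] lemma phaseRotation_zero {m : ℕ} (x : SympSpace m) : phaseRotation m 0 x = x := by
  simp [phaseRotation_apply]

lemma phaseRotation_phaseRotation {m : ℕ} (θ η : ℝ) (x : SympSpace m) :
    phaseRotation m θ (phaseRotation m η x) = phaseRotation m (θ + η) x := by
  simp only [phaseRotation_apply, map_add, map_smul, complexStructure_complexStructure,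
    Real.cos_add, Real.sin_add]
  module

lemma norm_phaseRotation {m : ℕ} (θ : ℝ) (x : SympSpace m) : ‖phaseRotation m θ x‖ = ‖x‖ := by
  have h : ‖phaseRotation m θ x‖ ^ 2 = ‖x‖ ^ 2 := by
    rw [phaseRotation_apply, norm_add_sq_real, norm_smul, norm_smul, inner_smul_left,
      inner_smul_right, inner_complexStructure_self, norm_complexStructure]
    simp only [Real.norm_eq_abs, mul_pow, sq_abs, mul_zero, add_zero]
    linear_combination ‖x‖ ^ 2 * Real.cos_sq_add_sin_sq θ
  exact (sq_eq_sq₀ (norm_nonneg _) (norm_nonneg _)).1 h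

lemma norm_phaseRotation_sub_le {m : ℕ} (θ : ℝ) (x : SympSpace m) :
    ‖phaseRotation m θ x - x‖ ≤ 2 * |θ| * ‖x‖ := by
  have h : phaseRotation m θ x - x
      = (Real.cos θ - Real.cos 0) • x + Real.sin θ • complexStructure m x := by
    rw [phaseRotation_apply, Real.cos_zero]; module
  rw [h]
  refine (norm_add_le _ _).trans ?_
  rw [norm_smul, norm_smul, norm_complexStructure, Real.norm_eq_abs, Real.norm_eq_abs]
  have h1 : |Real.cos θ - Real.cos 0| ≤ |θ| := by
    simpa using Real.abs_cos_sub_cos_le θ 0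
  have h2 : |Real.sin θ| ≤ |θ| := Real.abs_sin_le_abs
  nlinarith [norm_nonneg x]

lemma abs_det_phaseRotation (m : ℕ) (θ : ℝ) : |(phaseRotation m θ).det| = 1 := by
  have h := Measure.addHaar_image_continuousLinearMap (volume : Measure (SympSpace m))
    (phaseRotation m θ) (Metric.ball 0 1)
  have h2 : phaseRotation m θ '' Metric.ball 0 1 = Metric.ball 0 1 := by
    ext x
    constructor
    · rintro ⟨y, hy, rfl⟩
      simpa [norm_phaseRotation] using hy
    · intro hx
      refine ⟨phaseRotation m (-θ) x, by simpa [norm_phaseRotation] using hx, ?_⟩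
      simp [phaseRotation_phaseRotation]
  rw [h2] at h
  have hpos : volume (Metric.ball (0 : SympSpace m) 1) ≠ 0 :=
    (Metric.measure_ball_pos _ _ one_pos).ne'
  have h3 := (ENNReal.mul_eq_right hpos measure_ball_lt_top.ne).1 h.symm
  simpa using h3

/-- The twist about `c` with angle profile `κ`: each sphere about `c` is rotated by the phase
`κ (r ^ 2)`, where `r` is its radius. -/
noncomputable def twist {m : ℕ} (κ : ℝ → ℝ) (c x : SympSpace m) : SympSpace m :=
  c + phaseRotation m (κ (‖x - c‖ ^ 2)) (x - c)

lemma norm_twist_sub {m : ℕ} (κ : ℝ → ℝ) (c x : SympSpace m) : ‖twist κ c x - c‖ = ‖x - c‖ := by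
  rw [twist, add_sub_cancel_left, norm_phaseRotation]

lemma twist_neg_twist {m : ℕ} {κ₁ κ₂ : ℝ → ℝ} (h : ∀ s, κ₁ s + κ₂ s = 0) (c x : SympSpace m) :
    twist κ₁ c (twist κ₂ c x) = x := by
  rw [twist, norm_twist_sub]
  simp [twist, phaseRotation_phaseRotation, h]

lemma continuous_twist {m : ℕ} {κ : ℝ → ℝ} (hκ : Continuous κ) (c : SympSpace m) :
    Continuous (twist κ c) := by
  unfold twist
  simp only [phaseRotation_apply]
  fun_prop

/-- A twist as a homeomorphism; its inverse is the twist with the opposite profile. -/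
noncomputable def twistHomeomorph {m : ℕ} (κ : ℝ → ℝ) (hκ : Continuous κ) (c : SympSpace m) :
    SympSpace m ≃ₜ SympSpace m where
  toFun := twist κ c
  invFun := twist (fun s => -κ s) c
  left_inv := twist_neg_twist (fun s => by simp) c
  right_inv := twist_neg_twist (fun s => by simp) c
  continuous_toFun := continuous_twist hκ c
  continuous_invFun := continuous_twist hκ.neg c

/-- The derivative of a twist is a phase rotation composed with the transvection
`w ↦ w + 2 κ' ⟪u, w⟫ J u`, where `u = x - c`. -/
lemma hasFDerivAt_twist {m : ℕ} {κ : ℝ → ℝ} (hκ : Differentiable ℝ κ) (c x : SympSpace m) :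
    HasFDerivAt (twist κ c)
      ((phaseRotation m (κ (‖x - c‖ ^ 2))) ∘L
        (ContinuousLinearMap.id ℝ (SympSpace m) +
          ((2 * deriv κ (‖x - c‖ ^ 2)) • innerSL ℝ (x - c)).smulRight
            (complexStructure m (x - c)))) x := by
  have hu : HasFDerivAt (fun y : SympSpace m => y - c) (ContinuousLinearMap.id ℝ _) x :=
    (hasFDerivAt_id x).sub_const c
  have hn : HasFDerivAt (fun y : SympSpace m => ‖y - c‖ ^ 2) (2 • innerSL ℝ (x - c)) x := by
    simpa using hu.norm_sq
  have hθ : HasFDerivAt (fun y : SympSpace m => κ (‖y - c‖ ^ 2))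
      (deriv κ (‖x - c‖ ^ 2) • (2 • innerSL ℝ (x - c))) x :=
    (hκ _).hasDerivAt.comp_hasFDerivAt x hn
  have hJ : HasFDerivAt (fun y : SympSpace m => complexStructure m (y - c))
      (complexStructure m) x := by
    exact (complexStructure m).hasFDerivAt.comp x hu
  have h := ((hθ.cos.smul hu).add (hθ.sin.smul hJ)).const_add c
  refine h.congr_fderiv ?_
  ext1 w
  simp [phaseRotation_apply]
  module

lemma abs_det_fderiv_twist {m : ℕ} (θ s : ℝ) (u : SympSpace m) :
    |((phaseRotation m θ) ∘L (ContinuousLinearMap.id ℝ (SympSpace m) +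
          (s • innerSL ℝ u).smulRight (complexStructure m u))).det| = 1 := by
  have h : ((phaseRotation m θ) ∘L (ContinuousLinearMap.id ℝ (SympSpace m) +
          (s • innerSL ℝ u).smulRight (complexStructure m u))).det
      = (phaseRotation m θ).det * LinearMap.det
        (LinearMap.transvection ((s • innerSL ℝ u : SympSpace m →L[ℝ] ℝ) : SympSpace m →ₗ[ℝ] ℝ)
          (complexStructure m u)) := by
    rw [ContinuousLinearMap.det, ContinuousLinearMap.det, ← LinearMap.det_comp]
    rfl
  rw [h, abs_mul, abs_det_phaseRotation, LinearMap.transvection.det]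
  simp [inner_complexStructure_self]

lemma measurePreserving_twistHomeomorph {m : ℕ} {κ : ℝ → ℝ} (hκ : Differentiable ℝ κ)
    (c : SympSpace m) :
    MeasurePreserving (twistHomeomorph κ hκ.continuous c) := by
  suffices h : MeasurePreserving (twistHomeomorph κ hκ.continuous c).symm by
    exact h.symm (twistHomeomorph κ hκ.continuous c).symm.toMeasurableEquiv
  refine ⟨(twistHomeomorph κ hκ.continuous c).symm.continuous.measurable, ?_⟩
  ext s hs
  rw [Measure.map_apply (twistHomeomorph κ hκ.continuous c).symm.continuous.measurable hs,
    ← Homeomorph.image_eq_preimage_symm]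
  have h := lintegral_abs_det_fderiv_eq_addHaar_image (volume : Measure (SympSpace m)) hs
    (fun x _ => (hasFDerivAt_twist hκ c x).hasFDerivWithinAt)
    ((twistHomeomorph κ hκ.continuous c).injective.injOn)
  simp only [abs_det_fderiv_twist] at h
  simp only [ENNReal.ofReal_one, setLIntegral_one] at h
  exact h.symm

/-- A twist whose profile `k'` is the derivative of a smooth `k` vanishing beyond `b` is the
time-`τ` map of the flow of `k(|x - c|²) / 2`. -/
lemma twist_mem_hamiltonianDiffeos {m : ℕ} {k : ℝ → ℝ} (hk : ContDiff ℝ ∞ k) {b : ℝ} (hb : 0 ≤ b)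
    (hkb : ∀ s, b ^ 2 ≤ s → k s = 0) (τ : ℝ) {c : SympSpace m} {U : Set (SympSpace m)}
    (hU : Metric.closedBall c b ⊆ U) :
    twist (fun s => τ * deriv k s) c ∈ hamiltonianDiffeos U := by
  have hF : ContDiff ℝ ∞ (fun x : SympSpace m => τ / 2 * k (‖x - c‖ ^ 2)) :=
    contDiff_const.mul (hk.comp ((contDiff_id.sub contDiff_const).norm_sq ℝ))
  refine ⟨fun _ x => τ / 2 * k (‖x - c‖ ^ 2), fun t => twist (fun s => t * τ * deriv k s) c,
    Metric.closedBall c b, hF.comp contDiff_snd, isCompact_closedBall _ _, hU, ?_, ?_, ?_, ?_⟩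
  · intro _ x hx
    rw [Metric.mem_closedBall, dist_eq_norm, not_le] at hx
    simp [hkb _ (pow_le_pow_left₀ hb hx.le 2)]
  · intro x
    simp [twist]
  · intro t x
    set y := twist (fun s => t * τ * deriv k s) c x with hy
    have hyc : ‖y - c‖ = ‖x - c‖ := norm_twist_sub _ _ _
    have hn : HasFDerivAt (fun y : SympSpace m => ‖y - c‖ ^ 2) (2 • innerSL ℝ (y - c)) y := by
      simpa using ((hasFDerivAt_id y).sub_const c).norm_sq
    have hk1 : HasFDerivAt (fun x : SympSpace m => τ / 2 * k (‖x - c‖ ^ 2))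
        ((τ * deriv k (‖x - c‖ ^ 2)) • innerSL ℝ (y - c)) y := by
      have := (((hk.differentiable (by simp)) (‖y - c‖ ^ 2)).hasDerivAt.comp_hasFDerivAt y
        hn).const_mul (τ / 2)
      refine this.congr_fderiv ?_
      rw [hyc]
      ext1 w
      simp
      ring
    rw [hamiltonianVectorField_of_hasFDerivAt hk1]
    have hθ : HasDerivAt (fun s : ℝ => s * τ * deriv k (‖x - c‖ ^ 2))
        (τ * deriv k (‖x - c‖ ^ 2)) t := by
      simpa using ((hasDerivAt_id t).mul_const τ).mul_const (deriv k (‖x - c‖ ^ 2))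
    have h := ((hθ.cos.smul_const (x - c)).add
      (hθ.sin.smul_const (complexStructure m (x - c)))).const_add c
    refine h.congr_deriv ?_
    rw [hy, twist, add_sub_cancel_left, phaseRotation_apply, map_add, map_smul, map_smul,
      complexStructure_complexStructure]
    module
  · funext x
    simp [twist]

/-! ### Local translations -/

/-- The measure-preserving homeomorphisms that are Hamiltonian diffeomorphisms generated in `V`
and fix every point outside `V`. -/
def hamiltonianHomeos {m : ℕ} (V : Set (SympSpace m)) : Set (SympSpace m ≃ₜ SympSpace m) :=
  {g | ⇑g ∈ hamiltonianDiffeos V ∧ MeasurePreserving g ∧ ∀ x ∉ V, g x = x}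

lemma refl_mem_hamiltonianHomeos {m : ℕ} (V : Set (SympSpace m)) :
    Homeomorph.refl (SympSpace m) ∈ hamiltonianHomeos V :=
  ⟨id_mem_hamiltonianDiffeos V, MeasurePreserving.id _, fun _ _ => rfl⟩

lemma trans_mem_hamiltonianHomeos {m : ℕ} {V : Set (SympSpace m)}
    {g h : SympSpace m ≃ₜ SympSpace m} (hg : g ∈ hamiltonianHomeos V)
    (hh : h ∈ hamiltonianHomeos V) : g.trans h ∈ hamiltonianHomeos V :=
  ⟨comp_mem_hamiltonianDiffeos (g₁ := g) (g₂ := h) hg.1 hh.1, hh.2.1.comp hg.2.1, fun x hx => by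
    simp [hg.2.2 x hx, hh.2.2 x hx]⟩

lemma symm_apply_notMem {m : ℕ} {V : Set (SympSpace m)} {g : SympSpace m ≃ₜ SympSpace m}
    (hg : g ∈ hamiltonianHomeos V) {x : SympSpace m} (hx : x ∉ V) : g.symm x = x := by
  rw [Homeomorph.symm_apply_eq, hg.2.2 x hx]

lemma preimage_symm_eq {m : ℕ} {V : Set (SympSpace m)} {g : SympSpace m ≃ₜ SympSpace m}
    (hg : g ∈ hamiltonianHomeos V) : g.symm ⁻¹' V = V := by
  ext x
  constructor
  · intro hx
    by_contra hxV
    rw [Set.mem_preimage, symm_apply_notMem hg hxV] at hx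
    exact hxV hx
  · intro hx
    by_contra hxV
    have h := hg.2.2 _ hxV
    rw [Homeomorph.apply_symm_apply] at h
    exact hxV (by rw [Set.mem_preimage, ← h]; exact hx)

lemma measurePreserving_symm {m : ℕ} {V : Set (SympSpace m)} {g : SympSpace m ≃ₜ SympSpace m}
    (hg : g ∈ hamiltonianHomeos V) : MeasurePreserving g.symm :=
  MeasurePreserving.symm g.toMeasurableEquiv hg.2.1

lemma measurePreserving_symm_restrict {m : ℕ} {V : Set (SympSpace m)} (hV : MeasurableSet V)
    {g : SympSpace m ≃ₜ SympSpace m} (hg : g ∈ hamiltonianHomeos V) :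
    MeasurePreserving g.symm (volume.restrict V) (volume.restrict V) := by
  have h := (measurePreserving_symm hg).restrict_preimage hV
  rwa [preimage_symm_eq hg] at h

lemma twistHomeomorph_mem {m : ℕ} {k : ℝ → ℝ} (hk : ContDiff ℝ ∞ k) {b : ℝ} (hb : 0 ≤ b)
    (hkb : ∀ s, b ^ 2 ≤ s → k s = 0) (τ : ℝ) {c : SympSpace m} {V : Set (SympSpace m)}
    (hV : Metric.closedBall c b ⊆ V) (hd : Differentiable ℝ (fun s => τ * deriv k s)) :
    twistHomeomorph (fun s => τ * deriv k s) hd.continuous c ∈ hamiltonianHomeos V := by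
  have h1 : ⇑(twistHomeomorph (fun s => τ * deriv k s) hd.continuous c)
      = twist (fun s => τ * deriv k s) c := rfl
  refine ⟨?_, measurePreserving_twistHomeomorph hd c, fun x hx => ?_⟩
  · rw [h1]
    exact twist_mem_hamiltonianDiffeos hk hb hkb τ hV
  have hx' : b < ‖x - c‖ := by
    have : x ∉ Metric.closedBall c b := fun h => hx (hV h)
    simpa [dist_eq_norm] using this
  have h0 : deriv k (‖x - c‖ ^ 2) = 0 := by
    have hev : k =ᶠ[nhds (‖x - c‖ ^ 2)] fun _ => (0 : ℝ) := by
      filter_upwards [lt_mem_nhds (pow_lt_pow_left₀ hx' hb two_ne_zero)] with s hs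
        using hkb s hs.le
    rw [hev.deriv_eq]; simp
  rw [h1]
  simp [twist, h0]

lemma exists_smooth_cutoff {a b : ℝ} (hab : a < b) :
    ∃ k : ℝ → ℝ, ContDiff ℝ ∞ k ∧ (∀ s ≤ a, k s = s) ∧ ∀ s, b ≤ s → k s = 0 := by
  have hab' : 0 < b - a := sub_pos.2 hab
  refine ⟨fun s => s * (1 - Real.smoothTransition ((s - a) / (b - a))), ?_, ?_, ?_⟩
  · exact contDiff_id.mul (contDiff_const.sub (Real.smoothTransition.contDiff.comp
      ((contDiff_id.sub contDiff_const).div_const _)))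
  · intro s hs
    beta_reduce
    rw [Real.smoothTransition.zero_of_nonpos (div_nonpos_of_nonpos_of_nonneg (by linarith)
      hab'.le)]
    simp
  · intro s hs
    beta_reduce
    rw [Real.smoothTransition.one_of_one_le ((one_le_div hab').2 (by linarith))]
    simp

/-- Near any point of `V`, all small translations are realized by elements of
`hamiltonianHomeos V`, on a ball which does not depend on the allowed displacement `η`.
Each is the composition of two twists which near the point are rotations by opposite angles about
two distinct centres. -/
lemma exists_local_translation {m : ℕ} {V : Set (SympSpace m)} (hV : IsOpen V)
    {x₀ : SympSpace m} (hx₀ : x₀ ∈ V) :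
    ∃ r > 0, Metric.ball x₀ r ⊆ V ∧ ∀ η > 0, ∃ ρ > 0, ∀ y : SympSpace m, ‖y‖ ≤ ρ →
      ∃ h ∈ hamiltonianHomeos V, (∀ x ∈ Metric.ball x₀ r, h x = x + y) ∧
        ∀ x, dist (h x) x ≤ η := by
  obtain ⟨R, hR, hRV⟩ := Metric.nhds_basis_closedBall.mem_iff.1 (hV.mem_nhds hx₀)
  obtain ⟨r, hr, hrR⟩ : ∃ r : ℝ, 0 < r ∧ 4 * r = R := ⟨R / 4, by positivity, by ring⟩
  subst hrR
  refine ⟨r, hr, (Metric.ball_subset_closedBall.trans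
    (Metric.closedBall_subset_closedBall (by linarith))).trans hRV, fun η hη => ?_⟩
  obtain ⟨k, hk, hka, hkb⟩ := exists_smooth_cutoff (a := (2 * r) ^ 2) (b := (3 * r) ^ 2)
    (by nlinarith)
  have hk' : ContDiff ℝ ∞ (deriv k) := (contDiff_infty_iff_deriv.1 hk).2
  have hd : ∀ τ : ℝ, Differentiable ℝ (fun s => τ * deriv k s) := fun τ =>
    (hk'.differentiable (by simp)).const_mul τ
  have hk1 : ∀ s < (2 * r) ^ 2, deriv k s = 1 := by
    intro s hs
    have hev : k =ᶠ[nhds s] fun t => t := by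
      filter_upwards [gt_mem_nhds hs] with t ht using hka t ht.le
    rw [hev.deriv_eq]; simp
  obtain ⟨M, hM0, hM⟩ : ∃ M : ℝ, 0 ≤ M ∧ ∀ n, 0 ≤ n → |deriv k (n ^ 2)| * n ≤ M := by
    obtain ⟨M, hM⟩ := (isCompact_Icc (a := (0 : ℝ)) (b := 3 * r)).exists_bound_of_continuousOn
      (f := fun n => |deriv k (n ^ 2)| * n)
      (((hk'.continuous.comp (continuous_pow 2)).abs.mul continuous_id).continuousOn)
    have hM0 : 0 ≤ M := (norm_nonneg _).trans (hM 0 ⟨le_rfl, by positivity⟩)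
    refine ⟨M, hM0, fun n hn => ?_⟩
    rcases le_or_gt n (3 * r) with h | h
    · exact (le_abs_self _).trans (hM n ⟨hn, h⟩)
    · have hev : k =ᶠ[nhds (n ^ 2)] fun _ => (0 : ℝ) := by
        filter_upwards [lt_mem_nhds (pow_lt_pow_left₀ h (by positivity) two_ne_zero)] with s hs
          using hkb s hs.le
      rw [hev.deriv_eq]; simpa using hM0
  have hdisp : ∀ (τ : ℝ) (c x : SympSpace m),
      dist (twist (fun s => τ * deriv k s) c x) x ≤ 2 * |τ| * M := by
    intro τ c x
    have h1 : twist (fun s => τ * deriv k s) c x - x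
        = phaseRotation m (τ * deriv k (‖x - c‖ ^ 2)) (x - c) - (x - c) := by
      rw [twist]; abel
    rw [dist_eq_norm, h1]
    refine (norm_phaseRotation_sub_le _ _).trans ?_
    rw [abs_mul]
    calc 2 * (|τ| * |deriv k (‖x - c‖ ^ 2)|) * ‖x - c‖
        = 2 * |τ| * (|deriv k (‖x - c‖ ^ 2)| * ‖x - c‖) := by ring
      _ ≤ 2 * |τ| * M := by gcongr; exact hM _ (norm_nonneg _)
  obtain ⟨τ, hτ0, hτ1, hτM⟩ : ∃ τ : ℝ, 0 < τ ∧ τ ≤ 1 ∧ 4 * τ * M ≤ η := by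
    refine ⟨min 1 (η / (4 * (M + 1))), by positivity, min_le_left _ _, ?_⟩
    have h1 : min 1 (η / (4 * (M + 1))) * (4 * (M + 1)) ≤ η := by
      rw [← le_div_iff₀ (by positivity)]; exact min_le_right _ _
    have h2 : 0 < min 1 (η / (4 * (M + 1))) := by positivity
    nlinarith
  have hcos : Real.cos τ < 1 := by
    have := Real.cos_lt_cos_of_nonneg_of_le_pi le_rfl (by linarith [Real.pi_gt_three]) hτ0
    simpa using this
  -- `q = |e^{iτ} - 1| ^ 2`
  set q : ℝ := 2 - 2 * Real.cos τ with hq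
  have hq0 : 0 < q := by linarith
  refine ⟨r * q / 3, by positivity, fun y hy => ?_⟩
  -- rotating by `τ` about `x₀` and then by `-τ` about `x₀ - d` translates by `(e^{-iτ} - 1) d`
  set d : SympSpace m :=
    q⁻¹ • ((Real.cos τ - 1) • y + Real.sin τ • complexStructure m y) with hd_def
  have hdr : ‖d‖ ≤ r := by
    have h1 : ‖(Real.cos τ - 1) • y + Real.sin τ • complexStructure m y‖ ≤ 3 * ‖y‖ := by
      refine (norm_add_le _ _).trans ?_
      rw [norm_smul, norm_smul, norm_complexStructure, Real.norm_eq_abs, Real.norm_eq_abs]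
      have h2 : |Real.cos τ - 1| ≤ 2 := by
        rw [abs_le]; constructor <;> linarith [Real.neg_one_le_cos τ]
      have h3 := Real.abs_sin_le_one τ
      nlinarith [norm_nonneg y]
    rw [hd_def, norm_smul, Real.norm_of_nonneg (inv_nonneg.2 hq0.le), inv_mul_le_iff₀ hq0]
    linarith
  have hdy : phaseRotation m (-τ) d - d = y := by
    have hcs : (Real.cos τ - 1) ^ 2 + Real.sin τ ^ 2 = q := by
      rw [hq]; linear_combination Real.cos_sq_add_sin_sq τ
    have h1 : phaseRotation m (-τ) d - d
        = (q⁻¹ * ((Real.cos τ - 1) ^ 2 + Real.sin τ ^ 2)) • y := by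
      rw [phaseRotation_apply, hd_def]
      simp only [map_add, map_smul, complexStructure_complexStructure, Real.cos_neg,
        Real.sin_neg]
      module
    rw [h1, hcs, inv_mul_cancel₀ hq0.ne', one_smul]
  have hsub : Metric.closedBall (x₀ - d) (3 * r) ⊆ V := by
    refine (Metric.closedBall_subset_closedBall' ?_).trans hRV
    rw [dist_eq_norm]
    simp only [sub_sub_cancel_left, norm_neg]
    linarith
  have hsub₀ : Metric.closedBall x₀ (3 * r) ⊆ V :=
    (Metric.closedBall_subset_closedBall (by linarith)).trans hRV
  refine ⟨(twistHomeomorph (fun s => τ * deriv k s) (hd τ).continuous x₀).trans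
    (twistHomeomorph (fun s => -τ * deriv k s) (hd (-τ)).continuous (x₀ - d)), trans_mem_hamiltonianHomeos
      (twistHomeomorph_mem hk (by positivity) hkb τ hsub₀ (hd τ))
      (twistHomeomorph_mem hk (by positivity) hkb (-τ) hsub (hd (-τ))), ?_, ?_⟩
  · intro x hx
    rw [Metric.mem_ball, dist_eq_norm] at hx
    change twist (fun s => -τ * deriv k s) (x₀ - d) (twist (fun s => τ * deriv k s) x₀ x) = x + y
    set z := twist (fun s => τ * deriv k s) x₀ x with hz
    have hzx : ‖z - x₀‖ = ‖x - x₀‖ := norm_twist_sub _ _ _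
    have hzd : z - (x₀ - d) = (z - x₀) + d := by abel
    have hz1 : z - x₀ = phaseRotation m τ (x - x₀) := by
      rw [hz, twist, add_sub_cancel_left, hk1 _ (by gcongr; linarith), mul_one]
    have hzd' : ‖z - (x₀ - d)‖ < 2 * r := by
      rw [hzd]
      refine (norm_add_le _ _).trans_lt ?_
      linarith
    rw [twist, hk1 _ (by gcongr), mul_one, hzd, map_add, hz1, phaseRotation_phaseRotation]
    simp only [neg_add_cancel, phaseRotation_zero]
    rw [← hdy]
    abel
  · intro x
    change dist (twist (fun s => -τ * deriv k s) (x₀ - d) (twist (fun s => τ * deriv k s) x₀ x)) x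
      ≤ η
    refine (dist_triangle _ (twist (fun s => τ * deriv k s) x₀ x) _).trans ?_
    have h1 := hdisp (-τ) (x₀ - d) (twist (fun s => τ * deriv k s) x₀ x)
    have h2 := hdisp τ x₀ x
    rw [abs_neg] at h1
    rw [abs_of_pos hτ0] at h1 h2
    linarith

/-! ### Invariant functions are constant -/

/-- The averages of an invariant function over small balls of equal radius agree, because
local translations carry one ball to the other; by Lebesgue differentiation the function is
locally constant almost everywhere. -/
lemma exists_ball_ae_eq_const {m : ℕ} {V : Set (SympSpace m)} (hV : IsOpen V)
    {u : SympSpace m → ℝ} (hu : Integrable u)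
    (hinv : ∀ h ∈ hamiltonianHomeos V, u ∘ h.symm =ᵐ[volume] u) {x₀ : SympSpace m}
    (hx₀ : x₀ ∈ V) :
    ∃ r > 0, ∃ t : ℝ, ∀ᵐ x, x ∈ Metric.ball x₀ r → u x = t := by
  obtain ⟨r, hr, -, hη⟩ := exists_local_translation hV hx₀
  obtain ⟨ρ, hρ, hh⟩ := hη 1 one_pos
  refine ⟨ρ, hρ,
    Filter.limUnder (nhdsWithin 0 (Set.Ioi 0)) (fun s => ⨍ y in Metric.closedBall x₀ s, u y), ?_⟩
  filter_upwards [IsUnifLocDoublingMeasure.ae_tendsto_average volume hu.locallyIntegrable 1]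
    with z hz hzρ
  have h1 := hz (l := nhdsWithin (0 : ℝ) (Set.Ioi 0)) (fun _ => z) id Filter.tendsto_id (by
    filter_upwards [self_mem_nhdsWithin] with s hs
    simpa using le_of_lt hs)
  refine (Filter.Tendsto.limUnder_eq (h1.congr' ?_)).symm
  filter_upwards [Ioo_mem_nhdsGT hr] with s hs
  obtain ⟨h, hS, htr, -⟩ := hh (z - x₀) (by
    rw [← dist_eq_norm]; exact (Metric.mem_ball.1 hzρ).le)
  have himg : h.symm '' Metric.closedBall z s = Metric.closedBall x₀ s := by
    have : h '' Metric.closedBall x₀ s = Metric.closedBall z s := by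
      ext x
      constructor
      · rintro ⟨y, hy, rfl⟩
        rw [htr y (Metric.closedBall_subset_ball hs.2 hy), Metric.mem_closedBall, dist_eq_norm]
        rw [Metric.mem_closedBall, dist_eq_norm] at hy
        convert hy using 2
        abel
      · intro hx
        have hy : x - (z - x₀) ∈ Metric.closedBall x₀ s := by
          rw [Metric.mem_closedBall, dist_eq_norm] at hx ⊢
          convert hx using 2
          abel
        exact ⟨_, hy, by rw [htr _ (Metric.closedBall_subset_ball hs.2 hy)]; abel⟩
    rw [← this, ← Set.image_comp]
    simp
  have hint : ∫ y in Metric.closedBall x₀ s, u y = ∫ y in Metric.closedBall z s, u y := by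
    rw [← himg, (measurePreserving_symm hS).setIntegral_image_emb
      h.symm.measurableEmbedding]
    exact setIntegral_congr_ae measurableSet_closedBall
      ((hinv h hS).mono fun x hx _ => hx)
  simp only [id, setAverage_eq, hint, Measure.real, Measure.addHaar_closedBall_center]

lemma exists_ae_eq_const {m : ℕ} {V : Set (SympSpace m)} (hV : IsOpen V)
    (hVc : IsPreconnected V) (hVne : V.Nonempty)
    {u : SympSpace m → ℝ} (hu : Integrable u)
    (hinv : ∀ h ∈ hamiltonianHomeos V, u ∘ h.symm =ᵐ[volume] u) :
    ∃ t : ℝ, ∀ᵐ x, x ∈ V → u x = t := by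
  obtain ⟨x₀, hx₀⟩ := hVne
  obtain ⟨r₀, hr₀, t, ht⟩ := exists_ball_ae_eq_const hV hu hinv hx₀
  let W : Set (SympSpace m) := {x | ∃ r > 0, ∀ᵐ y, y ∈ Metric.ball x r → u y = t}
  have hW : IsOpen W := by
    rw [Metric.isOpen_iff]
    rintro x ⟨r, hr, hxr⟩
    refine ⟨r / 2, by positivity, fun y hy => ⟨r / 2, by positivity, ?_⟩⟩
    filter_upwards [hxr] with z hz hzy
    refine hz (Metric.mem_ball.2 ?_)
    linarith [dist_triangle z y x, Metric.mem_ball.1 hy, Metric.mem_ball.1 hzy]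
  have hsub : V ⊆ W := by
    refine hVc.subset_of_closure_inter_subset hW ⟨x₀, hx₀, r₀, hr₀, ht⟩ ?_
    rintro x ⟨hxW, hxV⟩
    obtain ⟨r, hr, t', ht'⟩ := exists_ball_ae_eq_const hV hu hinv hxV
    obtain ⟨y, ⟨s, hs, hys⟩, hxy⟩ := Metric.mem_closure_iff.1 hxW r hr
    -- the two constants agree on the open set where both balls meet
    have hpos : 0 < volume (Metric.ball x r ∩ Metric.ball y s) :=
      (Metric.isOpen_ball.inter Metric.isOpen_ball).measure_pos volume
        ⟨y, Metric.mem_ball'.2 hxy, Metric.mem_ball_self hs⟩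
    have hex : ∃ z ∈ Metric.ball x r ∩ Metric.ball y s, u z = t' ∧ u z = t := by
      by_contra hcon
      push Not at hcon
      refine hpos.ne' (measure_mono_null (t := {z | ¬ ((z ∈ Metric.ball x r → u z = t') ∧
        (z ∈ Metric.ball y s → u z = t))}) ?_ (ht'.and hys))
      exact fun z hz hz' => hcon z hz (hz'.1 hz.1) (hz'.2 hz.2)
    obtain ⟨z, -, h1, h2⟩ := hex
    exact ⟨r, hr, by rwa [← h2, h1]⟩
  refine ⟨t, ?_⟩
  have hnull : volume {x | ¬ (x ∈ V → u x = t)} = 0 := by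
    refine measure_null_of_locally_null _ fun x hx => ?_
    have hxV : x ∈ V := by by_contra h; exact hx fun h' => absurd h' h
    obtain ⟨r, hr, hxr⟩ := hsub hxV
    refine ⟨Metric.ball x r ∩ {x | ¬ (x ∈ V → u x = t)},
      Filter.inter_mem (mem_nhdsWithin_of_mem_nhds (Metric.ball_mem_nhds x hr))
        self_mem_nhdsWithin, measure_mono_null ?_ hxr⟩
    rintro y ⟨hy, hy'⟩ h
    exact hy' fun _ => h hy
  exact hnull

/-! ### The mean ergodic theorem for the convex hull of an orbit -/

/-- A closed convex set in a Hilbert space contains a vector fixed by every linear isometry that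
maps the set into itself: its vector of least norm. -/
lemma exists_fixed_of_isClosed_convex {H : Type*} [NormedAddCommGroup H] [InnerProductSpace ℝ H]
    [CompleteSpace H] {C : Set H} (hne : C.Nonempty) (hcl : IsClosed C) (hC : Convex ℝ C) :
    ∃ v ∈ C, ∀ T : H → H, (∀ w, ‖T w‖ = ‖w‖) → Set.MapsTo T C C → T v = v := by
  obtain ⟨v, hv, hmin⟩ := exists_norm_eq_iInf_of_complete_convex hne hcl.isComplete hC 0
  rw [norm_eq_iInf_iff_real_inner_le_zero hC hv] at hmin
  refine ⟨v, hv, fun T hT hTC => ?_⟩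
  have h1 := hmin (T v) (hTC hv)
  rw [zero_sub, inner_neg_left, inner_sub_right, real_inner_self_eq_norm_sq] at h1
  have h2 := norm_sub_sq_real (T v) v
  rw [hT, real_inner_comm] at h2
  have h3 : ‖T v - v‖ ^ 2 ≤ 0 := by linarith
  have h4 : ‖T v - v‖ = 0 := by nlinarith [norm_nonneg (T v - v)]
  exact sub_eq_zero.1 (norm_eq_zero.1 h4)

lemma integral_abs_le_Lp_two {α : Type*} [MeasurableSpace α] (μ : Measure α) [IsFiniteMeasure μ]
    (F : Lp ℝ 2 μ) : ∫ x, |F x| ∂μ ≤ ‖F‖ * (μ Set.univ ^ (1 / 2 : ℝ)).toReal := by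
  have h := eLpNorm_le_eLpNorm_mul_rpow_measure_univ (p := 1) (q := 2) (by norm_num)
    (Lp.aestronglyMeasurable F)
  have h1 : ∫ x, |F x| ∂μ = (eLpNorm F 1 μ).toReal := by
    rw [eLpNorm_one_eq_lintegral_enorm, ← integral_norm_eq_lintegral_enorm
      (Lp.aestronglyMeasurable F)]
    rfl
  have h2 : (1 / (1 : ENNReal).toReal - 1 / (2 : ENNReal).toReal) = (1 / 2 : ℝ) := by norm_num
  rw [h2] at h
  have hfin : μ Set.univ ^ (1 / 2 : ℝ) ≠ ⊤ :=
    ENNReal.rpow_ne_top_of_nonneg (by norm_num) (measure_ne_top _ _)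
  rw [h1, Lp.norm_def, ← ENNReal.toReal_mul]
  exact ENNReal.toReal_mono (ENNReal.mul_ne_top (Lp.eLpNorm_ne_top F) hfin) h

/-- The convex combinations of the translates `φ ∘ g⁻¹` of `φ` by `g ∈ hamiltonianHomeos V`. -/
def orbitHull {m : ℕ} (V : Set (SympSpace m)) (φ : SympSpace m → ℝ) : Set (SympSpace m → ℝ) :=
  convexHull ℝ {f | ∃ g ∈ hamiltonianHomeos V, f = φ ∘ g.symm}

lemma self_mem_orbitHull {m : ℕ} (V : Set (SympSpace m)) (φ : SympSpace m → ℝ) :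
    φ ∈ orbitHull V φ :=
  subset_convexHull ℝ _ ⟨Homeomorph.refl _, refl_mem_hamiltonianHomeos V, rfl⟩

lemma comp_symm_mem_orbitHull {m : ℕ} {V : Set (SympSpace m)} {φ f : SympSpace m → ℝ}
    (hf : f ∈ orbitHull V φ) {h : SympSpace m ≃ₜ SympSpace m} (hh : h ∈ hamiltonianHomeos V) :
    f ∘ h.symm ∈ orbitHull V φ := by
  have h1 : LinearMap.funLeft ℝ ℝ h.symm f ∈ LinearMap.funLeft ℝ ℝ h.symm '' orbitHull V φ :=
    ⟨f, hf, rfl⟩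
  rw [orbitHull, LinearMap.image_convexHull] at h1
  refine convexHull_mono ?_ h1
  rintro _ ⟨_, ⟨g, hg, rfl⟩, rfl⟩
  exact ⟨g.trans h, trans_mem_hamiltonianHomeos hg hh, rfl⟩

lemma orbitHull_properties {m : ℕ} {V : Set (SympSpace m)} {φ : SympSpace m → ℝ}
    (hφ : Continuous φ) (hφs : HasCompactSupport φ) (hφV : ∀ x ∉ V, φ x = 0)
    {f : SympSpace m → ℝ} (hf : f ∈ orbitHull V φ) :
    Continuous f ∧ HasCompactSupport f ∧ (∀ x ∉ V, f x = 0) ∧ ∫ x, f x = ∫ x, φ x := by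
  refine convexHull_min (t := {f : SympSpace m → ℝ | Continuous f ∧ HasCompactSupport f ∧
    (∀ x ∉ V, f x = 0) ∧ ∫ x, f x = ∫ x, φ x}) ?_ ?_ hf
  · rintro _ ⟨g, hg, rfl⟩
    refine ⟨hφ.comp g.symm.continuous, hφs.comp_homeomorph g.symm, fun x hx => ?_, ?_⟩
    · simp [symm_apply_notMem hg hx, hφV x hx]
    · exact (measurePreserving_symm hg).integral_comp g.symm.measurableEmbedding φ
  · rintro f₁ ⟨h1, h2, h3, h4⟩ f₂ ⟨k1, k2, k3, k4⟩ a b - - hab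
    refine ⟨(h1.const_smul a).add (k1.const_smul b), ?_, fun x hx => ?_, ?_⟩
    · exact (h2.mono (Function.support_const_smul_subset a f₁)).add
        (k2.mono (Function.support_const_smul_subset b f₂))
    · simp [h3 x hx, k3 x hx]
    · have i1 := (h1.integrable_of_hasCompactSupport (μ := volume) h2).const_mul a
      have i2 := (k1.integrable_of_hasCompactSupport (μ := volume) k2).const_mul b
      have := integral_add i1 i2
      simp only [integral_const_mul, h4, k4] at this
      simp only [Pi.add_apply, Pi.smul_apply, smul_eq_mul]
      rw [this, ← add_mul, hab, one_mul]

/-- Convex combinations of translates of `φ` come arbitrarily close, in `L¹(V)`, to the mean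
value of `φ` over `V`. -/
lemma exists_mem_orbitHull_integral_abs_sub_lt {m : ℕ} {V : Set (SympSpace m)} (hV : IsOpen V)
    (hVc : IsPreconnected V) (hVne : V.Nonempty) (hVfin : volume V ≠ ⊤) {φ : SympSpace m → ℝ}
    (hφ : Continuous φ) (hφs : HasCompactSupport φ) (hφV : ∀ x ∉ V, φ x = 0)
    {ε : ℝ} (hε : 0 < ε) :
    ∃ f ∈ orbitHull V φ, ∫ x in V, |f x - (∫ y, φ y) / volume.real V| < ε := by
  have : IsFiniteMeasure (volume.restrict V) := ⟨by simpa using hVfin.lt_top⟩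
  set μ : Measure (SympSpace m) := volume.restrict V with hμ
  have hmem : ∀ f ∈ orbitHull V φ, MemLp f 2 μ := fun f hf =>
    (orbitHull_properties hφ hφs hφV hf).1.memLp_of_hasCompactSupport
      (orbitHull_properties hφ hφs hφV hf).2.1
  let D : Set (Lp ℝ 2 μ) := {F | ∃ f ∈ orbitHull V φ, F =ᵐ[μ] f}
  have hDne : D.Nonempty :=
    ⟨(hmem φ (self_mem_orbitHull V φ)).toLp φ, φ, self_mem_orbitHull V φ, MemLp.coeFn_toLp _⟩
  have hDc : Convex ℝ D := by
    rintro F ⟨f, hf, hFf⟩ G ⟨g, hg, hGg⟩ a b ha hb hab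
    refine ⟨a • f + b • g, convex_convexHull ℝ _ hf hg ha hb hab, ?_⟩
    filter_upwards [hFf, hGg, Lp.coeFn_add (a • F) (b • G), Lp.coeFn_smul a F,
      Lp.coeFn_smul b G] with x h1 h2 h3 h4 h5
    rw [h3]
    simp only [Pi.add_apply, h4, h5, Pi.smul_apply, h1, h2]
  obtain ⟨v, hv, hfix⟩ := exists_fixed_of_isClosed_convex hDne.closure isClosed_closure
    hDc.closure
  have hvinv : ∀ h ∈ hamiltonianHomeos V, v ∘ h.symm =ᵐ[μ] v := by
    intro h hh
    have hmp := measurePreserving_symm_restrict hV.measurableSet hh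
    have hT := hfix (Lp.compMeasurePreserving h.symm hmp)
      (fun w => Lp.norm_compMeasurePreserving w hmp)
      (Set.MapsTo.closure (by
        rintro F ⟨f, hf, hFf⟩
        exact ⟨f ∘ h.symm, comp_symm_mem_orbitHull hf hh,
          (Lp.coeFn_compMeasurePreserving F hmp).trans
            (hmp.quasiMeasurePreserving.ae_eq_comp hFf)⟩)
        (Lp.isometry_compMeasurePreserving hmp).continuous)
    have h1 := Lp.coeFn_compMeasurePreserving v hmp
    rw [hT] at h1
    exact h1.symm
  have hvint : Integrable v μ := (Lp.memLp v).integrable (by norm_num)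
  obtain ⟨t, ht⟩ := exists_ae_eq_const hV hVc hVne (u := V.indicator v)
    ((integrable_indicator_iff hV.measurableSet).2 hvint) (by
      intro h hh
      have h1 := (ae_restrict_iff' hV.measurableSet).1 (hvinv h hh)
      filter_upwards [h1] with x hx
      have hiff : h.symm x ∈ V ↔ x ∈ V := by
        rw [← Set.mem_preimage, preimage_symm_eq hh]
      by_cases hxV : x ∈ V
      · simpa [hxV, hiff.2 hxV] using hx hxV
      · simp [hxV, hiff])
  have hvt : v =ᵐ[μ] fun _ => t := by
    refine (ae_restrict_iff' hV.measurableSet).2 ?_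
    filter_upwards [ht] with x hx hxV
    simpa [hxV] using hx hxV
  have happrox : ∀ δ > 0, ∃ f ∈ orbitHull V φ, ∫ x, |f x - t| ∂μ < δ := by
    intro δ hδ
    set B := (μ Set.univ ^ (1 / 2 : ℝ)).toReal with hB
    have hB0 : 0 ≤ B := ENNReal.toReal_nonneg
    obtain ⟨F, ⟨f, hf, hFf⟩, hF⟩ := Metric.mem_closure_iff.1 hv (δ / (B + 1)) (by positivity)
    refine ⟨f, hf, ?_⟩
    have h1 : ∫ x, |f x - t| ∂μ = ∫ x, |(F - v : Lp ℝ 2 μ) x| ∂μ := by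
      refine integral_congr_ae ?_
      filter_upwards [hFf, hvt, Lp.coeFn_sub F v] with x h1 h2 h3
      rw [h3, Pi.sub_apply, h1, h2]
    rw [h1]
    refine (integral_abs_le_Lp_two μ _).trans_lt ?_
    rw [dist_comm, dist_eq_norm, lt_div_iff₀ (by positivity)] at hF
    nlinarith [norm_nonneg (F - v)]
  have hVpos : 0 < volume.real V :=
    ENNReal.toReal_pos (hV.measure_pos volume hVne).ne' hVfin
  have hmean : ∀ f ∈ orbitHull V φ, ∫ x, f x ∂μ = ∫ y, φ y := by
    intro f hf
    obtain ⟨-, -, h3, h4⟩ := orbitHull_properties hφ hφs hφV hf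
    rw [← h4, hμ]
    exact setIntegral_eq_integral_of_forall_compl_eq_zero h3
  have htc : t = (∫ y, φ y) / volume.real V := by
    rw [eq_div_iff hVpos.ne']
    refine eq_of_forall_dist_le fun δ hδ => ?_
    rw [Real.dist_eq]
    obtain ⟨f, hf, hft⟩ := happrox δ hδ
    have hfi : Integrable f μ := (hmem f hf).integrable (by norm_num)
    have h1 : (∫ y, φ y) - t * volume.real V = ∫ x, (f x - t) ∂μ := by
      rw [integral_sub hfi (integrable_const t), hmean f hf, integral_const]
      simp [hμ, Measure.real, mul_comm]
    rw [abs_sub_comm, h1]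
    exact (abs_integral_le_integral_abs).trans hft.le
  rw [← htc]
  exact happrox ε hε

/-! ### Smoothing by local translations -/

/-- The averages of a compactly supported continuous function over balls of a fixed radius are
uniformly approximated by finite convex combinations of its translates: as an average in the
space of bounded continuous functions, they lie in the closed convex hull of the translates. -/
lemma exists_convexCombination_translates {E : Type*} [NormedAddCommGroup E] [NormedSpace ℝ E]
    [FiniteDimensional ℝ E] [MeasurableSpace E] [BorelSpace E] (μ : Measure E) [μ.IsAddHaarMeasure]
    {f : E → ℝ} (hf : Continuous f) (hfs : HasCompactSupport f) {ρ : ℝ} (hρ : 0 < ρ)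
    {ε : ℝ} (hε : 0 < ε) :
    ∃ (ι : Type) (_ : Fintype ι) (w : ι → ℝ) (y : ι → E), (∀ i, 0 ≤ w i) ∧ ∑ i, w i = 1 ∧
      (∀ i, ‖y i‖ ≤ ρ) ∧
      ∀ x, |∑ i, w i * f (x - y i) - ⨍ y in Metric.closedBall 0 ρ, f (x - y) ∂μ| ≤ ε := by
  obtain ⟨C, hC⟩ := hf.bounded_above_of_compact_support hfs
  have huc : UniformContinuous f := hfs.uniformContinuous_of_continuous hf
  let F : BoundedContinuousFunction E ℝ := BoundedContinuousFunction.ofNormedAddCommGroup f hf C hC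
  let G : E → BoundedContinuousFunction E ℝ := fun y =>
    F.compContinuous ⟨fun x => x - y, by fun_prop⟩
  have hG : Continuous G := by
    rw [Metric.continuous_iff]
    intro y δ hδ
    obtain ⟨κ, hκ, h⟩ := Metric.uniformContinuous_iff.1 huc (δ / 2) (by positivity)
    refine ⟨κ, hκ, fun z hz => ?_⟩
    refine lt_of_le_of_lt ((BoundedContinuousFunction.dist_le (by positivity)).2 fun x => ?_)
      (half_lt_self hδ)
    exact (h (a := x - z) (b := x - y) (by simpa [dist_eq_norm, norm_sub_rev] using hz)).le
  have hGi : IntegrableOn G (Metric.closedBall 0 ρ) μ :=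
    hG.continuousOn.integrableOn_compact (isCompact_closedBall 0 ρ)
  have hav := (convex_convexHull ℝ (G '' Metric.closedBall 0 ρ)).set_average_mem_closure
    (μ := μ) (t := Metric.closedBall 0 ρ) (f := G)
    (Metric.measure_closedBall_pos μ _ hρ).ne' measure_closedBall_lt_top.ne
    (by
      filter_upwards [ae_restrict_mem measurableSet_closedBall] with y hy
      exact subset_convexHull ℝ _ ⟨y, hy, rfl⟩) hGi
  obtain ⟨g, hg, hgε⟩ := Metric.mem_closure_iff.1 hav ε hε
  obtain ⟨ι, _, w, z, hw0, hw1, hz, rfl⟩ := mem_convexHull_iff_exists_fintype.1 hg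
  choose y hy hyz using hz
  refine ⟨ι, inferInstance, w, y, hw0, hw1, fun i => by simpa using hy i, fun x => ?_⟩
  have h1 : (⨍ y in Metric.closedBall 0 ρ, G y ∂μ) x
      = ⨍ y in Metric.closedBall 0 ρ, f (x - y) ∂μ := by
    have := ContinuousLinearMap.integral_comp_comm
      (BoundedContinuousFunction.evalCLM ℝ x) hGi
    rw [setAverage_eq, setAverage_eq]
    simp only [BoundedContinuousFunction.coe_smul]
    congr 1
    exact this.symm
  have h2 : (∑ i, w i • z i) x = ∑ i, w i * f (x - y i) := by
    rw [BoundedContinuousFunction.sum_apply]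
    refine Finset.sum_congr rfl fun i _ => ?_
    rw [← hyz i]
    rfl
  rw [← h1, ← h2, ← Real.dist_eq]
  exact (BoundedContinuousFunction.dist_coe_le_dist x).trans (by rw [dist_comm]; exact hgε.le)

lemma le_average_translate {m : ℕ} {V : Set (SympSpace m)} (hVfin : volume V ≠ ⊤)
    {f : SympSpace m → ℝ} (hf : Continuous f) (hfs : HasCompactSupport f) (c : ℝ) {ρ : ℝ}
    (hρ : 0 < ρ) {x : SympSpace m} (hx : Metric.closedBall x ρ ⊆ V) :
    c - (volume.real (Metric.closedBall (0 : SympSpace m) ρ))⁻¹ * ∫ y in V, |f y - c|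
      ≤ ⨍ y in Metric.closedBall 0 ρ, f (x - y) := by
  set B := Metric.closedBall (0 : SympSpace m) ρ with hB
  have hBpos : 0 < volume.real B := ENNReal.toReal_pos
    (Metric.measure_closedBall_pos volume _ hρ).ne' measure_closedBall_lt_top.ne
  have hVi : IntegrableOn (fun y => |f y - c|) V :=
    ((hf.integrable_of_hasCompactSupport hfs).integrableOn.sub
      (integrableOn_const hVfin)).abs
  have h1 : ∫ y in B, |f (x - y) - c| ≤ ∫ y in V, |f y - c| := by
    have hpre : (fun y => x - y) ⁻¹' Metric.closedBall x ρ = B := by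
      ext y; simp [hB, dist_eq_norm]
    rw [← hpre, (Measure.measurePreserving_sub_left volume x).setIntegral_preimage_emb
      (MeasurableEquiv.subLeft x).measurableEmbedding (fun y => |f y - c|)]
    exact setIntegral_mono_set hVi (ae_of_all _ fun _ => abs_nonneg _) hx.eventuallyLE
  have hcont : Continuous fun y => f (x - y) := by fun_prop
  have hBi : IntegrableOn (fun y => f (x - y)) B :=
    hcont.continuousOn.integrableOn_compact (isCompact_closedBall 0 ρ)
  have hci : IntegrableOn (fun _ : SympSpace m => c) B :=
    integrableOn_const measure_closedBall_lt_top.ne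
  have habs : IntegrableOn (fun y => |f (x - y) - c|) B := (hBi.sub hci).abs
  have h2 : c * volume.real B - ∫ y in B, |f (x - y) - c| ≤ ∫ y in B, f (x - y) := by
    have h3 : c * volume.real B = ∫ y in B, c := by simp [mul_comm]
    rw [h3, ← integral_sub hci habs]
    refine integral_mono (hci.sub habs) hBi fun y => ?_
    simp only
    linarith [neg_abs_le (f (x - y) - c)]
  rw [setAverage_eq, smul_eq_mul]
  have h4 : c - (volume.real B)⁻¹ * ∫ y in V, |f y - c|
      = (volume.real B)⁻¹ * (c * volume.real B - ∫ y in V, |f y - c|) := by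
    field_simp
  rw [h4]
  gcongr
  linarith

/-- Averaging over local translations near `x₀` turns `L¹` closeness to the constant `c` into a
pointwise lower bound near `x₀`. It does not increase the `L¹` distance, and it spoils lower
bounds that hold elsewhere only within the displacement `η`. -/
lemma exists_local_smoothing {m : ℕ} {V : Set (SympSpace m)} (hV : IsOpen V)
    (hVfin : volume V ≠ ⊤) {φ : SympSpace m → ℝ}
    (hφ : Continuous φ) (hφs : HasCompactSupport φ) (hφV : ∀ x ∉ V, φ x = 0) (c : ℝ)
    {x₀ : SympSpace m} (hx₀ : x₀ ∈ V) :
    ∃ δ > 0, ∀ η > 0, ∃ K : ℝ, 0 ≤ K ∧ ∀ f ∈ orbitHull V φ, ∀ ε > 0, ∃ f' ∈ orbitHull V φ,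
      ∫ x in V, |f' x - c| ≤ ∫ x in V, |f x - c| ∧
      (∀ x t, (∀ y, dist y x ≤ η → t ≤ f y) → t ≤ f' x) ∧
      ∀ x ∈ Metric.ball x₀ δ, c - K * (∫ x in V, |f x - c|) - ε ≤ f' x := by
  obtain ⟨r, hr, hrV, hh⟩ := exists_local_translation hV hx₀
  refine ⟨r / 2, by positivity, fun η hη => ?_⟩
  obtain ⟨ρ₁, hρ₁, htr⟩ := hh η hη
  set ρ := min ρ₁ (r / 2) with hρ_def
  have hρ : 0 < ρ := by positivity
  refine ⟨(volume.real (Metric.closedBall (0 : SympSpace m) ρ))⁻¹, by positivity,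
    fun f hf ε hε => ?_⟩
  obtain ⟨hfc, hfs, -, -⟩ := orbitHull_properties hφ hφs hφV hf
  obtain ⟨ι, _, w, y, hw0, hw1, hy, hsum⟩ :=
    exists_convexCombination_translates volume hfc hfs hρ hε
  choose h hS hht hhd using fun i => htr (y i) ((hy i).trans (min_le_left _ _))
  have hVi : ∀ g : SympSpace m → ℝ, g ∈ orbitHull V φ →
      IntegrableOn (fun y => |g y - c|) V := fun g hg => by
    obtain ⟨hgc, hgs, -, -⟩ := orbitHull_properties hφ hφs hφV hg
    exact ((hgc.integrable_of_hasCompactSupport hgs).integrableOn.sub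
      (integrableOn_const hVfin)).abs
  have hmem : ∀ i, f ∘ (h i).symm ∈ orbitHull V φ := fun i => comp_symm_mem_orbitHull hf (hS i)
  have hVh : ∀ i, IntegrableOn (fun x => w i * |f ((h i).symm x) - c|) V := fun i =>
    (hVi _ (hmem i)).const_mul (w i)
  have hf'mem : (fun x => ∑ i, w i * f ((h i).symm x)) ∈ orbitHull V φ := by
    have h1 : (fun x => ∑ i, w i * f ((h i).symm x)) = ∑ i, w i • (f ∘ (h i).symm) := by
      ext x
      simp
    rw [h1]
    exact (convex_convexHull ℝ _).sum_mem (fun i _ => hw0 i) hw1 (fun i _ => hmem i)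
  refine ⟨_, hf'mem, ?_, ?_, ?_⟩
  · calc ∫ x in V, |∑ i, w i * f ((h i).symm x) - c|
        ≤ ∫ x in V, ∑ i, w i * |f ((h i).symm x) - c| := by
          refine integral_mono (hVi _ hf'mem)
            (integrable_finsetSum _ fun i _ => hVh i) fun x => ?_
          have h1 : ∑ i, w i * f ((h i).symm x) - c
              = ∑ i, w i * (f ((h i).symm x) - c) := by
            simp only [mul_sub, Finset.sum_sub_distrib, ← Finset.sum_mul, hw1, one_mul]
          simp only
          rw [h1]
          refine (Finset.abs_sum_le_sum_abs _ _).trans_eq ?_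
          simp only [abs_mul, abs_of_nonneg (hw0 _)]
      _ = ∑ i, w i * ∫ x in V, |f ((h i).symm x) - c| := by
          rw [integral_finsetSum _ fun i _ => hVh i]
          simp only [integral_const_mul]
      _ = ∑ i, w i * ∫ x in V, |f x - c| := by
          refine Finset.sum_congr rfl fun i _ => ?_
          rw [(measurePreserving_symm_restrict hV.measurableSet (hS i)).integral_comp
            (h i).symm.measurableEmbedding (fun x => |f x - c|)]
      _ = ∫ x in V, |f x - c| := by rw [← Finset.sum_mul, hw1, one_mul]
  · intro x t hxt
    calc t = ∑ i, w i * t := by rw [← Finset.sum_mul, hw1, one_mul]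
      _ ≤ ∑ i, w i * f ((h i).symm x) := by
        refine Finset.sum_le_sum fun i _ => mul_le_mul_of_nonneg_left (hxt _ ?_) (hw0 i)
        have := hhd i ((h i).symm x)
        rwa [Homeomorph.apply_symm_apply, dist_comm] at this
  · intro x hx
    have hρr : ρ ≤ r / 2 := min_le_right _ _
    have hsub : Metric.closedBall x ρ ⊆ Metric.ball x₀ r := by
      intro z hz
      rw [Metric.mem_closedBall] at hz
      rw [Metric.mem_ball] at hx ⊢
      linarith [dist_triangle z x x₀]
    have h1 := le_average_translate hVfin hfc hfs c hρ (hsub.trans hrV)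
    have h2 : ∀ i, (h i).symm x = x - y i := by
      intro i
      rw [Homeomorph.symm_apply_eq, hht i _ (hsub (by simpa [dist_eq_norm] using hy i))]
      abel
    simp only [h2]
    linarith [neg_abs_le (∑ i, w i * f (x - y i) - ⨍ y in Metric.closedBall 0 ρ, f (x - y)),
      hsum x]

/-- Composing finitely many local smoothings gives a lower bound on a whole compact set. The
displacement of each later smoothing is chosen smaller than the margin left by the earlier
ones. -/
lemma exists_smoothing {m : ℕ} {V : Set (SympSpace m)} (hV : IsOpen V)
    (hVfin : volume V ≠ ⊤) {φ : SympSpace m → ℝ}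
    (hφ : Continuous φ) (hφs : HasCompactSupport φ) (hφV : ∀ x ∉ V, φ x = 0) (c : ℝ)
    {X : Set (SympSpace m)} (hX : IsCompact X) (hXV : X ⊆ V) :
    ∃ δ > 0, ∀ η > 0, ∃ K : ℝ, 0 ≤ K ∧ ∀ f ∈ orbitHull V φ, ∀ ε > 0, ∃ f' ∈ orbitHull V φ,
      ∫ x in V, |f' x - c| ≤ ∫ x in V, |f x - c| ∧
      (∀ x t, (∀ y, dist y x ≤ η → t ≤ f y) → t ≤ f' x) ∧
      ∀ x ∈ Metric.thickening δ X, c - K * (∫ x in V, |f x - c|) - ε ≤ f' x := by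
  refine hX.induction_on (p := fun s => ∃ δ > 0, ∀ η > 0, ∃ K : ℝ, 0 ≤ K ∧
    ∀ f ∈ orbitHull V φ, ∀ ε > 0, ∃ f' ∈ orbitHull V φ,
      ∫ x in V, |f' x - c| ≤ ∫ x in V, |f x - c| ∧
      (∀ x t, (∀ y, dist y x ≤ η → t ≤ f y) → t ≤ f' x) ∧
      ∀ x ∈ Metric.thickening δ s, c - K * (∫ x in V, |f x - c|) - ε ≤ f' x) ?_ ?_ ?_ ?_
  · exact ⟨1, one_pos, fun η hη => ⟨0, le_rfl, fun f hf ε hε => ⟨f, hf, le_rfl,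
      fun x t h => h x (by simpa using hη.le), fun x hx => by simp at hx⟩⟩⟩
  · rintro s t hst ⟨δ, hδ, h⟩
    refine ⟨δ, hδ, fun η hη => ?_⟩
    obtain ⟨K, hK, h⟩ := h η hη
    refine ⟨K, hK, fun f hf ε hε => ?_⟩
    obtain ⟨f', hf', h1, h2, h3⟩ := h f hf ε hε
    exact ⟨f', hf', h1, h2, fun x hx => h3 x (Metric.thickening_subset_of_subset δ hst hx)⟩
  · rintro s t ⟨δ₁, hδ₁, hs⟩ ⟨δ₂, hδ₂, ht⟩
    refine ⟨min (δ₁ / 2) δ₂, by positivity, fun η hη => ?_⟩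
    obtain ⟨K₁, hK₁, hs⟩ := hs (η / 2) (by positivity)
    obtain ⟨K₂, hK₂, ht⟩ := ht (min (η / 2) (δ₁ / 2)) (by positivity)
    refine ⟨max K₁ K₂, le_max_of_le_left hK₁, fun f hf ε hε => ?_⟩
    obtain ⟨f₁, hf₁, a1, a2, a3⟩ := hs f hf ε hε
    obtain ⟨f₂, hf₂, b1, b2, b3⟩ := ht f₁ hf₁ ε hε
    have he : 0 ≤ ∫ x in V, |f x - c| := integral_nonneg fun _ => abs_nonneg _
    refine ⟨f₂, hf₂, b1.trans a1, fun x u hu => ?_, fun x hx => ?_⟩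
    · refine b2 x u fun y hy => a2 y u fun z hz => hu z ?_
      have := hy.trans (min_le_left _ _)
      linarith [dist_triangle z y x]
    · rw [Metric.thickening_union] at hx
      rcases hx with hx | hx
      · have h1 : c - K₁ * (∫ x in V, |f x - c|) - ε ≤ f₂ x := by
          refine b2 x _ fun y hy => a3 y ?_
          rw [Metric.mem_thickening_iff] at hx ⊢
          obtain ⟨z, hz, hxz⟩ := hx
          refine ⟨z, hz, ?_⟩
          have h2 := hy.trans (min_le_right _ _)
          have h3 := hxz.trans_le (min_le_left _ _)
          linarith [dist_triangle y x z]
        have h2 : K₁ * (∫ x in V, |f x - c|) ≤ max K₁ K₂ * (∫ x in V, |f x - c|) := by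
          gcongr; exact le_max_left _ _
        linarith
      · have h1 := b3 x (Metric.thickening_mono (min_le_right _ _) t hx)
        have h2 : K₂ * (∫ x in V, |f₁ x - c|) ≤ max K₁ K₂ * (∫ x in V, |f x - c|) := by
          gcongr; exact le_max_right _ _
        linarith
  · intro x hx
    obtain ⟨δ, hδ, h⟩ := exists_local_smoothing hV hVfin hφ hφs hφV c (hXV hx)
    refine ⟨Metric.ball x (δ / 2), mem_nhdsWithin_of_mem_nhds
      (Metric.ball_mem_nhds x (by positivity)), δ / 2, by positivity, fun η hη => ?_⟩
    obtain ⟨K, hK, h⟩ := h η hη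
    refine ⟨K, hK, fun f hf ε hε => ?_⟩
    obtain ⟨f', hf', h1, h2, h3⟩ := h f hf ε hε
    refine ⟨f', hf', h1, h2, fun y hy => h3 y ?_⟩
    obtain ⟨z, hz, hyz⟩ := Metric.mem_thickening_iff.1 hy
    rw [Metric.mem_ball] at hz ⊢
    linarith [dist_triangle y z x]

/-- Some convex combination of translates of `φ` is at least half the mean value of `φ` at every
point of a compact set. -/
lemma exists_mem_orbitHull_ge {m : ℕ} {V : Set (SympSpace m)} (hV : IsOpen V)
    (hVc : IsPreconnected V) (hVne : V.Nonempty) (hVfin : volume V ≠ ⊤) {φ : SympSpace m → ℝ}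
    (hφ : Continuous φ) (hφs : HasCompactSupport φ) (hφV : ∀ x ∉ V, φ x = 0)
    (hφpos : 0 < ∫ y, φ y) {X : Set (SympSpace m)} (hX : IsCompact X) (hXV : X ⊆ V) :
    ∃ f ∈ orbitHull V φ, ∀ x ∈ X, (∫ y, φ y) / volume.real V / 2 ≤ f x := by
  have hVpos : 0 < volume.real V :=
    ENNReal.toReal_pos (hV.measure_pos volume hVne).ne' hVfin
  set c := (∫ y, φ y) / volume.real V with hc
  have hc0 : 0 < c := by positivity
  obtain ⟨δ, hδ, h⟩ := exists_smoothing hV hVfin hφ hφs hφV c hX hXV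
  obtain ⟨K, hK, h⟩ := h 1 one_pos
  obtain ⟨f, hf, hfc⟩ := exists_mem_orbitHull_integral_abs_sub_lt hV hVc hVne hVfin hφ hφs hφV
    (ε := c / (4 * (K + 1))) (by positivity)
  obtain ⟨f', hf', -, -, h3⟩ := h f hf (c / 4) (by positivity)
  refine ⟨f', hf', fun x hx => ?_⟩
  have h4 := h3 x (Metric.self_subset_thickening hδ X hx)
  have h5 : K * (∫ x in V, |f x - c|) ≤ c / 4 := by
    rw [lt_div_iff₀ (by positivity)] at hfc
    have : 0 ≤ ∫ x in V, |f x - c| := integral_nonneg fun _ => abs_nonneg _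
    nlinarith
  linarith

/-! ### The covering -/

/-- Rounding the weights up to multiples of `1 / n`, where `n` is the number of terms, replaces a
convex combination by a uniform average at the cost of a factor `2`. -/
lemma exists_uniform_average_ge {m : ℕ} {V : Set (SympSpace m)} {φ f : SympSpace m → ℝ}
    (hφ : ∀ x, 0 ≤ φ x) (hf : f ∈ orbitHull V φ) :
    ∃ (M : ℕ) (g : Fin M → SympSpace m ≃ₜ SympSpace m), (∀ j, g j ∈ hamiltonianHomeos V) ∧
      ∀ x, f x / 2 ≤ 1 / (M : ℝ) * ∑ j, φ ((g j).symm x) := by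
  obtain ⟨ι, _, w, z, hw0, hw1, hz, rfl⟩ := mem_convexHull_iff_exists_fintype.1 hf
  choose g hg hgz using hz
  set n := Fintype.card ι with hn
  have hn0 : 0 < n := by
    rw [hn, Fintype.card_pos_iff]
    by_contra h
    rw [not_nonempty_iff] at h
    simp at hw1
  have hn0' : (0 : ℝ) < n := by exact_mod_cast hn0
  let k : ι → ℕ := fun i => ⌈n * w i⌉₊
  have hk : ∀ i, (n : ℝ) * w i ≤ k i := fun i => Nat.le_ceil _
  have hk' : ∀ i, (k i : ℝ) ≤ n * w i + 1 := fun i =>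
    (Nat.ceil_lt_add_one (mul_nonneg hn0'.le (hw0 i))).le
  have hcard : Fintype.card (Σ i, Fin (k i)) = ∑ i, k i := by simp
  let e : Fin (∑ i, k i) ≃ Σ i, Fin (k i) := (Fintype.equivFinOfCardEq hcard).symm
  have hsum : ∀ x, ∑ j, φ ((g (e j).1).symm x) = ∑ i, (k i : ℝ) * φ ((g i).symm x) := by
    intro x
    rw [e.sum_comp (fun p : Σ i, Fin (k i) => φ ((g p.1).symm x)), Fintype.sum_sigma]
    simp
  have hM : ((∑ i, k i : ℕ) : ℝ) ≤ 2 * n := by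
    push_cast
    calc ∑ i, (k i : ℝ) ≤ ∑ i, ((n : ℝ) * w i + 1) := Finset.sum_le_sum fun i _ => hk' i
      _ = 2 * n := by
        rw [Finset.sum_add_distrib, ← Finset.mul_sum, hw1]
        simp [← hn]
        ring
  have hM0 : (0 : ℝ) < ((∑ i, k i : ℕ) : ℝ) := by
    push_cast
    calc (0 : ℝ) < n := hn0'
      _ = ∑ i, (n : ℝ) * w i := by rw [← Finset.mul_sum, hw1, mul_one]
      _ ≤ ∑ i, (k i : ℝ) := Finset.sum_le_sum fun i _ => hk i
  refine ⟨∑ i, k i, fun j => g (e j).1, fun j => hg _, fun x => ?_⟩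
  have hfx : (∑ i, w i • z i) x = ∑ i, w i * φ ((g i).symm x) := by
    simp [hgz]
  rw [hsum, hfx, one_div, ← div_eq_inv_mul]
  calc (∑ i, w i * φ ((g i).symm x)) / 2
      = (∑ i, n * w i * φ ((g i).symm x)) / (2 * n) := by
        simp only [mul_assoc, ← Finset.mul_sum]
        field_simp
    _ ≤ (∑ i, (k i : ℝ) * φ ((g i).symm x)) / (2 * n) := by
        gcongr with i
        · exact hφ _
        · exact hk i
    _ ≤ (∑ i, (k i : ℝ) * φ ((g i).symm x)) / ((∑ i, k i : ℕ) : ℝ) := by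
        refine div_le_div_of_nonneg_left ?_ hM0 hM
        exact Finset.sum_nonneg fun i _ => mul_nonneg (Nat.cast_nonneg _) (hφ _)

lemma exists_isOpen_isPreconnected_volume_le {m : ℕ} {X U : Set (SympSpace m)} (hX : IsCompact X)
    (hXc : IsConnected X) (hU : IsOpen U) (hXU : X ⊆ U) (hpos : volume X ≠ 0) :
    ∃ V ⊆ U, IsOpen V ∧ IsPreconnected V ∧ X ⊆ V ∧ volume V ≤ 2 * volume X := by
  have hfin : volume X ≠ ⊤ := hX.measure_lt_top.ne
  have hlt : volume X < 2 * volume X := by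
    rw [two_mul]
    exact ENNReal.lt_add_right hfin hpos
  obtain ⟨O, hXO, hO, hOlt⟩ := X.exists_isOpen_lt_of_lt _ hlt
  obtain ⟨x₀, hx₀⟩ := hXc.nonempty
  exact ⟨connectedComponentIn (O ∩ U) x₀,
    (connectedComponentIn_subset _ _).trans Set.inter_subset_right,
    (hO.inter hU).connectedComponentIn, isPreconnected_connectedComponentIn,
    hXc.isPreconnected.subset_connectedComponentIn hx₀ (Set.subset_inter hXO hXU),
    (measure_mono ((connectedComponentIn_subset _ _).trans Set.inter_subset_left)).trans
      hOlt.le⟩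

lemma exists_bump_half_volume_le {m : ℕ} {A : Set (SympSpace m)} (hA : IsOpen A)
    (hAne : A.Nonempty) (hfin : volume A ≠ ⊤) :
    ∃ φ : SympSpace m → ℝ, Continuous φ ∧ HasCompactSupport φ ∧ (∀ x ∉ A, φ x = 0) ∧
      (∀ x, 0 ≤ φ x) ∧ (∀ x, φ x ≤ 1) ∧ volume.real A / 2 ≤ ∫ x, φ x := by
  have hpos : volume A ≠ 0 := (hA.measure_pos volume hAne).ne'
  obtain ⟨K, hKA, hK, hlt⟩ := hA.exists_lt_isCompact (ENNReal.half_lt_self hpos hfin)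
  obtain ⟨φ, h1, h0, hs, hφ⟩ := exists_continuous_one_zero_of_isCompact hK hA.isClosed_compl
    (Set.disjoint_compl_right_iff_subset.2 hKA)
  refine ⟨φ, φ.continuous, hs, fun x hx => h0 hx, fun x => (hφ x).1, fun x => (hφ x).2, ?_⟩
  have hKreal : volume.real A / 2 ≤ volume.real K := by
    have := ENNReal.toReal_mono hK.measure_lt_top.ne hlt.le
    simpa [Measure.real] using this
  refine hKreal.trans ?_
  have hKint : volume.real K = ∫ x, K.indicator (fun _ => (1 : ℝ)) x := by
    rw [integral_indicator hK.measurableSet]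
    simp
  rw [hKint]
  refine integral_mono ((integrable_indicator_iff hK.measurableSet).2
    (integrableOn_const hK.measure_lt_top.ne))
    (φ.continuous.integrable_of_hasCompactSupport hs) fun x => ?_
  by_cases hx : x ∈ K
  · simp [hx, h1 hx]
  · simpa [hx] using (hφ x).1

theorem proposition4p2 :
    ∃ C₂ : ℝ, 1 ≤ C₂ ∧ ∀ m : ℕ, ∃ C₁ : ℝ, 0 ≤ C₁ ∧
      ∀ X U : Set (SympSpace m),
        IsCompact X → IsConnected X → IsOpen U → IsCompact (closure U) → X ⊆ U →
        ∀ A : Set (SympSpace m), IsOpen A → A.Nonempty → A ⊆ interior X →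
          ∃ (M : ℕ) (g : Fin M → SympSpace m → SympSpace m),
            (∀ j, g j ∈ hamiltonianDiffeos U) ∧
            X ⊆ ⋃ j, g j '' A ∧
            ∀ x ∈ X, (C₁ + C₂ * (volume.real X / volume.real A))⁻¹ ≤
              1 / (M : ℝ) * countingFunction (fun j => g j '' A) x := by
  -- a factor `2` is lost in each of `μ V ≤ 2 μ X`, `∫ φ ≥ μ A / 2`, the pointwise lower bound by
  -- half the mean value, and the rounding of the weights
  refine ⟨16, by norm_num, fun m => ⟨0, le_rfl, ?_⟩⟩
  intro X U hX hXc hU _ hXU A hA hAne hAX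
  have hAX' : A ⊆ X := hAX.trans interior_subset
  have hApos : volume A ≠ 0 := (hA.measure_pos volume hAne).ne'
  have hXfin : volume X ≠ ⊤ := hX.measure_lt_top.ne
  have hAfin : volume A ≠ ⊤ := measure_ne_top_of_subset hAX' hXfin
  have hXpos : volume X ≠ 0 := fun h => hApos (measure_mono_null hAX' h)
  obtain ⟨V, hVU, hV, hVc, hXV, hVX⟩ :=
    exists_isOpen_isPreconnected_volume_le hX hXc hU hXU hXpos
  have hVne : V.Nonempty := hXc.nonempty.mono hXV
  have hVfin : volume V ≠ ⊤ := ne_top_of_le_ne_top (ENNReal.mul_ne_top (by simp) hXfin) hVX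
  obtain ⟨φ, hφ, hφs, hφA, hφ0, hφ1, hφI⟩ := exists_bump_half_volume_le hA hAne hAfin
  have hA0 : 0 < volume.real A := ENNReal.toReal_pos hApos hAfin
  have hX0 : 0 < volume.real X := ENNReal.toReal_pos hXpos hXfin
  have hV0 : 0 < volume.real V := ENNReal.toReal_pos (hV.measure_pos volume hVne).ne' hVfin
  have hVX' : volume.real V ≤ 2 * volume.real X := by
    have := ENNReal.toReal_mono (ENNReal.mul_ne_top (by simp) hXfin) hVX
    simpa [Measure.real] using this
  have hI0 : 0 < ∫ x, φ x := by linarith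
  obtain ⟨f, hf, hfX⟩ := exists_mem_orbitHull_ge hV hVc hVne hVfin hφ hφs
    (fun x hx => hφA x fun h => hx (hXV (hAX' h))) hI0 hX hXV
  obtain ⟨M, g, hg, hgf⟩ := exists_uniform_average_ge hφ0 hf
  have hcount : ∀ x, ∑ j, φ ((g j).symm x) ≤ countingFunction (fun j => g j '' A) x := by
    intro x
    refine Finset.sum_le_sum fun j _ => ?_
    by_cases hx : (g j).symm x ∈ A
    · have : x ∈ g j '' A := ⟨_, hx, (g j).apply_symm_apply x⟩
      simpa [this] using hφ1 _
    · rw [hφA _ hx]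
      exact Set.indicator_nonneg (fun _ _ => zero_le_one) _
  have hbound : ∀ x ∈ X, (0 + 16 * (volume.real X / volume.real A))⁻¹ ≤
      1 / (M : ℝ) * countingFunction (fun j => g j '' A) x := by
    intro x hx
    calc (0 + 16 * (volume.real X / volume.real A))⁻¹
        = volume.real A / 2 / (2 * volume.real X) / 2 / 2 := by
          field_simp
          ring
      _ ≤ (∫ y, φ y) / volume.real V / 2 / 2 := by gcongr
      _ ≤ f x / 2 := by gcongr; exact hfX x hx
      _ ≤ 1 / (M : ℝ) * ∑ j, φ ((g j).symm x) := hgf x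
      _ ≤ 1 / (M : ℝ) * countingFunction (fun j => g j '' A) x := by gcongr; exact hcount x
  refine ⟨M, fun j => g j, fun j => hamiltonianDiffeos_mono hVU (hg j).1, fun x hx => ?_,
    hbound⟩
  by_contra hcon
  have hzero : countingFunction (fun j => g j '' A) x = 0 := by
    refine Finset.sum_eq_zero fun j _ => Set.indicator_of_notMem (fun h => hcon ?_) _
    exact Set.mem_iUnion.2 ⟨j, h⟩
  have h1 := hbound x hx
  rw [hzero, mul_zero] at h1
  have h2 : 0 < (0 + 16 * (volume.real X / volume.real A))⁻¹ := by positivity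
  linarith
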